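/- Let $n\ge 1$ be an integer and let $q$ be a prime power. Let $PG(n-1,q)$ be the matroid whose ground set $E$ is the set of points of the projective space of dimension $n-1$ over the field $\mathbb F_q$ with $q$ elements, the rank of a set of points being the dimension of the linear subspace of $\mathbb F_q^n$ that it spans. Let $PG(n-1,q)^*$ be the dual matroid, and for a matroid $M$ with finite ground set $E$ and rank function $r$ let $\chi_M(x)=\sum_{A\subseteq E}(-1)^{|A|}x^{r(E)-r(A)}$ be its characteristic polynomial. Put $$N=\frac{q^n-1}{q-1},\qquad N'=N-n,\qquad k=q^{n-1}-1 .$$ Then $0\le k\le N'$, the polynomial $\chi_{PG(n-1,q)^*}(x)$ has no terms of degree greater than $N'$ (for $n\ge 2$ its degree is exactly $N'$; for $n=1$ it is the zero polynomial and $k=N'=0$), and its $k$ leading terms are $$x^{N'}-N x^{N'-1}+\binom N2 x^{N'-2}-\dots+(-1)^{k-1}\binom N{k-1}x^{N'-k+1},$$ that is, for every $0\le i\le k-1$ the coefficient of $x^{N'-i}$ in $\chi_{PG(n-1,q)^*}(x)$ is $(-1)^i\binom Ni$. -/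

import Mathlib

open scoped LinearAlgebra.Projectivization Matroid
open Polynomial

/-- The characteristic polynomial `∑_{A ⊆ E} (-1)^|A| x^(r(E) - r(A))` of a matroid `M` with
finite ground set `E` and rank function `r`. The subtraction of natural numbers is exact, since
`r` is monotone and takes finite values. -/
noncomputable def Matroid.characteristicPolynomial {α : Type*} (M : Matroid α) [M.Finite] :
    ℤ[X] :=
  ∑ A ∈ M.ground_finite.toFinset.powerset,
    (-1) ^ A.card * X ^ ((M.eRk M.E).toNat - (M.eRk (A : Set α)).toNat)

/-- The augmentation property for linearly independent sets of points. -/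
theorem Projectivization.linearIndepOn_rep_augment {F V : Type*} [Field F] [AddCommGroup V]
    [Module F V] [Finite V] {I J : Set (ℙ F V)}
    (hI : LinearIndepOn F Projectivization.rep I) (hJ : LinearIndepOn F Projectivization.rep J)
    (hIJ : I.ncard < J.ncard) :
    ∃ e ∈ J, e ∉ I ∧ LinearIndepOn F Projectivization.rep (insert e I) := by
  have : Finite (ℙ F V) := inferInstance
  have : Module.Finite F V := Module.Finite.of_finite
  by_contra! hcon
  have hsub : ∀ e ∈ J, Projectivization.rep e ∈
      Submodule.span F (Projectivization.rep '' I) := by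
    intro e he
    by_cases heI : e ∈ I
    · exact Submodule.subset_span ⟨e, heI, rfl⟩
    · by_contra hns
      exact hcon e he heI (hI.insert hns)
  have hle : Submodule.span F (Projectivization.rep '' J) ≤
      Submodule.span F (Projectivization.rep '' I) := by
    rw [Submodule.span_le]
    rintro _ ⟨e, he, rfl⟩
    exact hsub e he
  have hcard : ∀ K : Set (ℙ F V), LinearIndepOn F Projectivization.rep K →
      Module.finrank F (Submodule.span F (Projectivization.rep '' K)) = K.ncard := by
    intro K hK
    have := Fintype.ofFinite K
    have h := finrank_span_eq_card (R := F) (b := fun p : K => Projectivization.rep p.1) hK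
    rw [Set.image_eq_range, h, ← Nat.card_eq_fintype_card, Nat.card_coe_set_eq]
  have := Submodule.finrank_mono hle
  rw [hcard I hI, hcard J hJ] at this
  omega

/-- The matroid of the projective space of a finite vector space `V` over a field `F`: the ground
set consists of all points, and a set of points is independent if vectors representing its points
are linearly independent. -/
noncomputable def projectiveSpaceMatroid (F V : Type*) [Field F] [AddCommGroup V] [Module F V]
    [Finite V] : Matroid (ℙ F V) :=
  (IndepMatroid.ofFinite (E := Set.univ) Set.finite_univ
    (fun I => LinearIndepOn F Projectivization.rep I)
    (linearIndepOn_empty F _)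
    (fun _ _ hJ hIJ => hJ.mono hIJ)
    (fun _ _ hI hJ hIJ => Projectivization.linearIndepOn_rep_augment hI hJ hIJ)
    (fun _ _ => Set.subset_univ _)).matroid

instance projectiveSpaceMatroid_finite (F V : Type*) [Field F] [AddCommGroup V] [Module F V]
    [Finite V] : (projectiveSpaceMatroid F V).Finite :=
  IndepMatroid.ofFinite_finite ..

/-- The rank of a set of points is the dimension of the linear space that it spans. -/
theorem projectiveSpaceMatroid_eRk (F V : Type*) [Field F] [AddCommGroup V] [Module F V]
    [Finite V] (A : Set (ℙ F V)) :
    (projectiveSpaceMatroid F V).eRk A =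
      (Module.finrank F (⨆ p ∈ A, p.submodule : Submodule F V) : ℕ∞) := by
  have : Module.Finite F V := Module.Finite.of_finite
  obtain ⟨I, hI⟩ := (projectiveSpaceMatroid F V).exists_isBasis' A
  have hli : LinearIndepOn F Projectivization.rep I := hI.indep
  have hspan : (⨆ p ∈ A, p.submodule : Submodule F V) =
      Submodule.span F (Projectivization.rep '' I) := by
    apply le_antisymm
    · refine iSup₂_le fun e he => ?_
      rw [Projectivization.submodule_eq, Submodule.span_singleton_le_iff_mem]
      by_cases heI : e ∈ I
      · exact Submodule.subset_span ⟨e, heI, rfl⟩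
      · by_contra hns
        exact heI (hI.mem_of_insert_indep he
          (show LinearIndepOn F Projectivization.rep (insert e I) from hli.insert hns))
    · rw [Submodule.span_le]
      rintro _ ⟨e, he, rfl⟩
      have h : e.submodule ≤ (⨆ p ∈ A, p.submodule : Submodule F V) :=
        le_iSup₂_of_le e (hI.subset he) le_rfl
      apply h
      rw [Projectivization.submodule_eq]
      exact Submodule.mem_span_singleton_self _
  have := Fintype.ofFinite I
  have h := finrank_span_eq_card (R := F) (b := fun p : I => Projectivization.rep p.1) hli
  rw [hspan, Set.image_eq_range, h, ← hI.encard_eq_eRk, ← Nat.card_eq_fintype_card,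
    Nat.card_coe_set_eq, I.toFinite.cast_ncard_eq]

/-- The matroid `PG(n - 1, q)`, where `F` is the field with `q` elements: its ground set is the
set of points of the projective space of dimension `n - 1` over `F`. -/
noncomputable abbrev matroidPG (n : ℕ) (F : Type*) [Field F] [Finite F] :
    Matroid (ℙ F (Fin n → F)) :=
  projectiveSpaceMatroid F (Fin n → F)

/-!
In a matroid in which every set of at most `k` elements is independent, a set `A` has rank `i < k`
if and only if it has `i` elements: the rank of a set with more than `k` elements is at least `k`.
Hence only the `i`-element sets contribute to the coefficient of `x ^ (r(E) - i)` in the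
characteristic polynomial, and that coefficient is `(-1) ^ i` times the number of these sets
(`Matroid.coeff_characteristicPolynomial_of_indep`).

This applies to the dual of `PG(n - 1, q)` with `k = q ^ (n - 1) - 1`. A set `A` is independent in
the dual if and only if the complement of `A` spans. If the complement does not span, it lies in a
hyperplane `ker φ`, so `A` contains all points outside `ker φ`. Such points have unique
representatives in the affine hyperplane `φ = 1`, so there are `q ^ (n - 1)` of them
(`Projectivization.card_pow_finrank_le_ncard`), more than the at most `k` elements of `A`.
-/

/-- The ranks of a matroid and its dual add up to the number of elements, since the bases of the
dual are the complements of bases. -/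
theorem Matroid.toNat_eRk_dual_ground_add {α : Type*} (M : Matroid α) [M.Finite] :
    (M✶.eRk M✶.E).toNat + (M.eRk M.E).toNat = M.E.ncard := by
  obtain ⟨B, hB⟩ := M.exists_isBase
  rw [M.eRk_ground, M✶.eRk_ground, ← hB.encard_eq_eRank,
    ← hB.compl_isBase_dual.encard_eq_eRank]
  exact Set.ncard_sdiff_add_ncard_of_subset hB.subset_ground M.ground_finite

theorem Matroid.toNat_eRk_le_of_subset {α : Type*} (M : Matroid α) [M.Finite] {A B : Set α}
    (h : A ⊆ B) : (M.eRk A).toNat ≤ (M.eRk B).toNat :=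
  ENat.toNat_le_toNat (M.eRk_mono h) (M.isRkFinite_set B).eRk_lt_top.ne

theorem Matroid.natDegree_characteristicPolynomial_le {α : Type*} (M : Matroid α) [M.Finite] :
    M.characteristicPolynomial.natDegree ≤ (M.eRk M.E).toNat := by
  refine natDegree_sum_le_of_forall_le _ _ fun A _ => ?_
  have h : ((-1 : ℤ[X]) ^ A.card) = C ((-1) ^ A.card) := by simp
  rw [h]
  exact (natDegree_C_mul_X_pow_le _ _).trans (Nat.sub_le _ _)

/-- If all sets with at most `k` elements are independent, then the ranks smaller than `k` are the
ranks of the sets with fewer than `k` elements. -/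
theorem Matroid.toNat_eRk_eq_iff_of_indep {α : Type*} (M : Matroid α) [M.Finite] {k : ℕ}
    (hM : ∀ A : Finset α, (A : Set α) ⊆ M.E → A.card ≤ k → M.Indep A)
    {A : Finset α} (hA : (A : Set α) ⊆ M.E) {i : ℕ} (hi : i < k) :
    (M.eRk (A : Set α)).toNat = i ↔ A.card = i := by
  have hrank : ∀ B : Finset α, (B : Set α) ⊆ M.E → B.card ≤ k →
      (M.eRk (B : Set α)).toNat = B.card := fun B hB hBk => by
    rw [(hM B hB hBk).eRk_eq_encard, Set.encard_coe_eq_coe_finsetCard, ENat.toNat_natCast]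
  rcases le_total A.card k with h | h
  · rw [hrank A hA h]
  · obtain ⟨B, hBA, hB⟩ := Finset.exists_subset_card_eq h
    have hBA' : (B : Set α) ⊆ A := Finset.coe_subset.2 hBA
    have h1 := M.toNat_eRk_le_of_subset hBA'
    rw [hrank B (hBA'.trans hA) hB.le] at h1
    omega

theorem Matroid.le_toNat_eRk_ground_of_indep {α : Type*} (M : Matroid α) [M.Finite] {k : ℕ}
    (hM : ∀ A : Finset α, (A : Set α) ⊆ M.E → A.card ≤ k → M.Indep A)
    (hk : k ≤ M.E.ncard) : k ≤ (M.eRk M.E).toNat := by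
  rw [Set.ncard_eq_toFinset_card _ M.ground_finite] at hk
  obtain ⟨B, hBE, hB⟩ := Finset.exists_subset_card_eq hk
  have hBE' : (B : Set α) ⊆ M.E := fun x hx => M.ground_finite.mem_toFinset.1 (hBE hx)
  have h1 := M.toNat_eRk_le_of_subset hBE'
  rwa [(hM B hBE' hB.le).eRk_eq_encard, Set.encard_coe_eq_coe_finsetCard, ENat.toNat_natCast,
    hB] at h1

/-- The leading coefficients of the characteristic polynomial of a matroid without circuits of at
most `k` elements. -/
theorem Matroid.coeff_characteristicPolynomial_of_indep {α : Type*} (M : Matroid α) [M.Finite]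
    {k : ℕ} (hM : ∀ A : Finset α, (A : Set α) ⊆ M.E → A.card ≤ k → M.Indep A)
    (hk : k ≤ M.E.ncard) {i : ℕ} (hi : i < k) :
    M.characteristicPolynomial.coeff ((M.eRk M.E).toNat - i) =
      (-1) ^ i * (M.E.ncard.choose i : ℤ) := by
  have hkr := M.le_toNat_eRk_ground_of_indep hM hk
  have hterm : ∀ A ∈ M.ground_finite.toFinset.powerset,
      ((-1 : ℤ[X]) ^ A.card * X ^ ((M.eRk M.E).toNat - (M.eRk (A : Set α)).toNat)).coeff
        ((M.eRk M.E).toNat - i) = if A.card = i then (-1) ^ i else 0 := by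
    intro A hA
    have hAE : (A : Set α) ⊆ M.E := fun x hx =>
      M.ground_finite.mem_toFinset.1 (Finset.mem_powerset.1 hA hx)
    have hle := M.toNat_eRk_le_of_subset hAE
    have hC : ((-1 : ℤ[X]) ^ A.card) = C ((-1) ^ A.card) := by simp
    rw [hC, coeff_C_mul_X_pow]
    have hiff : (M.eRk M.E).toNat - i = (M.eRk M.E).toNat - (M.eRk (A : Set α)).toNat ↔
        A.card = i := by
      rw [← M.toNat_eRk_eq_iff_of_indep hM hAE hi]
      omega
    simp only [hiff]
    split_ifs with h
    · rw [h]
    · rfl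
  rw [Matroid.characteristicPolynomial, finsetSum_coeff, Finset.sum_congr rfl hterm,
    ← Finset.sum_filter, ← Finset.powersetCard_eq_filter, Finset.sum_const,
    Finset.card_powersetCard, Set.ncard_eq_toFinset_card _ M.ground_finite, nsmul_eq_mul, mul_comm]

/-- A set that contains all points outside a hyperplane contains the points represented by the
vectors of a translate of this hyperplane. -/
theorem Projectivization.card_pow_finrank_le_ncard {F V : Type*} [Field F] [Finite F]
    [AddCommGroup V] [Module F V] [Finite V] {φ : Module.Dual F V} (hφ : φ ≠ 0) {A : Set (ℙ F V)}
    (hA : ∀ p : ℙ F V, φ p.rep ≠ 0 → p ∈ A) :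
    Nat.card F ^ (Module.finrank F V - 1) ≤ A.ncard := by
  have : Module.Finite F V := Module.Finite.of_finite
  obtain ⟨v, hv⟩ : ∃ v, φ v ≠ 0 := by
    by_contra! h
    exact hφ (LinearMap.ext h)
  obtain ⟨u, hu⟩ : ∃ u, φ u = 1 := ⟨(φ v)⁻¹ • v, by simp [hv]⟩
  have hone : ∀ w : LinearMap.ker φ, φ (u + w) = 1 := fun w => by
    rw [map_add, hu, LinearMap.mem_ker.1 w.2, add_zero]
  have hne : ∀ w : LinearMap.ker φ, u + (w : V) ≠ 0 := fun w h => by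
    have := hone w
    rw [h, map_zero] at this
    exact zero_ne_one this
  have hmem : ∀ w : LinearMap.ker φ, Projectivization.mk F (u + (w : V)) (hne w) ∈ A := by
    intro w
    obtain ⟨a, ha⟩ := Projectivization.exists_smul_eq_mk_rep F (u + (w : V)) (hne w)
    apply hA
    rw [← ha, Units.smul_def, map_smul, hone]
    simp
  have hinj : Function.Injective fun w : LinearMap.ker φ => (⟨_, hmem w⟩ : A) := by
    intro w w' h
    obtain ⟨a, ha⟩ := (Projectivization.mk_eq_mk_iff' F _ _ _ _).1 (Subtype.ext_iff.1 h)
    have h1 := congrArg φ ha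
    rw [map_smul, hone, hone, smul_eq_mul, mul_one] at h1
    rw [h1, one_smul] at ha
    exact Subtype.ext (add_left_cancel ha).symm
  have hcard := Nat.card_le_card_of_injective _ hinj
  rw [Module.natCard_eq_pow_finrank (K := F), Nat.card_coe_set_eq] at hcard
  rwa [← Module.Dual.finrank_ker_add_one_of_ne_zero hφ, Nat.add_sub_cancel]

/-- In the dual of a projective space of dimension `d - 1` over the field with `q` elements, every
set of fewer than `q ^ (d - 1)` points is independent. -/
theorem projectiveSpaceMatroid_dual_indep {F V : Type*} [Field F] [Finite F]
    [AddCommGroup V] [Module F V] [Finite V] {A : Set (ℙ F V)}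
    (hA : A.ncard < Nat.card F ^ (Module.finrank F V - 1)) :
    (projectiveSpaceMatroid F V)✶.Indep A := by
  obtain ⟨I, hI⟩ := (projectiveSpaceMatroid F V).exists_isBasis Aᶜ (Set.subset_univ _)
  have hli : LinearIndepOn F Projectivization.rep I := hI.indep
  have hspan : Submodule.span F (Projectivization.rep '' I) = ⊤ := by
    by_contra hne
    obtain ⟨φ, hφ, hle⟩ := Submodule.exists_le_ker_of_lt_top _ (lt_top_iff_ne_top.2 hne)
    refine hA.not_ge (Projectivization.card_pow_finrank_le_ncard hφ fun p hp => ?_)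
    by_contra hpA
    apply hp
    apply hle
    by_cases hpI : p ∈ I
    · exact Submodule.subset_span ⟨p, hpI, rfl⟩
    · by_contra hns
      exact hpI (hI.mem_of_insert_indep hpA
        (show LinearIndepOn F Projectivization.rep (insert p I) from hli.insert hns))
  have hbase : (projectiveSpaceMatroid F V).IsBase I := by
    refine hI.indep.isBase_of_maximal fun J hJ hIJ => hIJ.antisymm fun p hp => ?_
    by_contra hpI
    have hJli : LinearIndepOn F Projectivization.rep J := hJ
    refine (hJli.mono (Set.insert_subset hp hIJ)).notMem_span_of_insert hpI ?_
    rw [hspan]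
    trivial
  exact Matroid.coindep_iff_subset_compl_isBase.2
    ⟨I, hbase, fun p hp => ⟨Set.mem_univ p, fun hpI => hI.subset hpI hp⟩⟩

theorem matroidPG_toNat_eRk_ground (n : ℕ) (F : Type*) [Field F] [Finite F] :
    ((matroidPG n F).eRk (matroidPG n F).E).toNat = n := by
  have h : (⨆ p ∈ (Set.univ : Set (ℙ F (Fin n → F))), p.submodule) = ⊤ := by
    rw [eq_top_iff]
    intro v _
    by_cases hv : v = 0
    · rw [hv]
      exact zero_mem _
    · have hle := le_iSup₂_of_le (f := fun (p : ℙ F (Fin n → F)) (_ : p ∈ Set.univ) => p.submodule)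
        (Projectivization.mk F v hv) (Set.mem_univ _) le_rfl
      apply hle
      rw [Projectivization.submodule_mk]
      exact Submodule.mem_span_singleton_self v
  have hE : (matroidPG n F).E = Set.univ := rfl
  rw [hE, projectiveSpaceMatroid_eRk, h, finrank_top, Module.finrank_fin_fun, ENat.toNat_natCast]

/-- For `n ≥ 1` and a finite field `F` with `q` elements, put `N = (q^n - 1)/(q - 1)` (an exact
division), `N' = N - n` and `k = q^(n-1) - 1`. Then the `k` leading terms of the characteristic
polynomial of the dual of `PG(n - 1, q)` are `(-1)^i (N choose i) x^(N' - i)`, `0 ≤ i < k`, and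
there are no terms of degree above `N'`. The parts `n ≤ N` and `k ≤ N'` say that the
subtractions of natural numbers are exact. -/
theorem corollary3 (n : ℕ) (hn : 1 ≤ n) (F : Type*) [Field F] [Finite F] (q N N' k : ℕ)
    (hq : q = Nat.card F) (hN : N = (q ^ n - 1) / (q - 1)) (hN' : N' = N - n)
    (hk : k = q ^ (n - 1) - 1) :
    n ≤ N ∧ k ≤ N' ∧
      (matroidPG n F)✶.characteristicPolynomial.natDegree = N' ∧
      ∀ i < k, (matroidPG n F)✶.characteristicPolynomial.coeff (N' - i) =
        (-1) ^ i * (N.choose i : ℤ) := by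
  have hfin : Module.finrank F (Fin n → F) = n := Module.finrank_fin_fun F
  have hE : (matroidPG n F).E.ncard = N := by
    have h : (matroidPG n F).E = Set.univ := rfl
    rw [h, Set.ncard_univ, Projectivization.card'', Module.natCard_eq_pow_finrank (K := F), hfin,
      hN, hq]
  have hE' : (matroidPG n F)✶.E.ncard = N := hE
  have hsum := (matroidPG n F).toNat_eRk_dual_ground_add
  rw [matroidPG_toNat_eRk_ground, hE] at hsum
  have hr : ((matroidPG n F)✶.eRk (matroidPG n F)✶.E).toNat = N' := by omega
  have hpos : 0 < q ^ (n - 1) := by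
    rw [hq]
    exact pow_pos Nat.card_pos _
  have hindep : ∀ A : Finset (ℙ F (Fin n → F)), (A : Set (ℙ F (Fin n → F))) ⊆
      (matroidPG n F)✶.E → A.card ≤ k → (matroidPG n F)✶.Indep A := by
    intro A _ hA
    apply projectiveSpaceMatroid_dual_indep
    rw [Set.ncard_coe_finset, hfin, ← hq]
    omega
  have hkN : k ≤ N := by
    have h := Projectivization.card_of_finrank F (Fin n → F) hfin
    rw [Projectivization.card'', Module.natCard_eq_pow_finrank (K := F), hfin, ← hq, ← hN] at h
    rw [h, hk]
    exact (Nat.sub_le _ _).trans (Finset.single_le_sum (f := fun i => q ^ i)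
      (fun _ _ => Nat.zero_le _) (Finset.mem_range.2 (by omega : n - 1 < n)))
  have hkN' : k ≤ N' := by
    rw [← hr]
    exact Matroid.le_toNat_eRk_ground_of_indep _ hindep (hkN.trans hE'.ge)
  have hcoeff : ∀ i < k, (matroidPG n F)✶.characteristicPolynomial.coeff (N' - i) =
      (-1) ^ i * (N.choose i : ℤ) := by
    intro i hi
    have h := Matroid.coeff_characteristicPolynomial_of_indep _ hindep (hkN.trans hE'.ge) hi
    rwa [hr, hE'] at h
  have hdeg : (matroidPG n F)✶.characteristicPolynomial.natDegree ≤ N' := by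
    rw [← hr]
    exact Matroid.natDegree_characteristicPolynomial_le _
  refine ⟨by omega, hkN', hdeg.antisymm ?_, hcoeff⟩
  rcases Nat.eq_zero_or_pos k with h0 | h0
  · -- `q ^ (n - 1) = 1` forces `n = 1`; then `N' = 0`, and nothing is claimed about the
    -- leading coefficient.
    have hq1 : 1 < q := by
      rw [hq]
      exact Finite.one_lt_card
    have hn1 : n = 1 := by
      by_contra hne
      have := Nat.one_lt_pow (by omega : n - 1 ≠ 0) hq1
      omega
    have hN1 : N = 1 := by
      rw [hN, hn1, pow_one, Nat.div_self (by omega)]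
    omega
  · apply le_natDegree_of_ne_zero
    have h := hcoeff 0 h0
    rw [Nat.sub_zero] at h
    rw [h]
    simp
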